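/- For a positive integer $N$ let $n=\pi(N)$ be the number of primes $\le N$ and let $p_1<\dots<p_n$ be these primes. For $1\le M\le N$ write $M=\prod_{i=1}^n p_i^{x_{i,M}}$ with $x_{i,M}\in\mathbf Z_{\ge 0}$, put $v_M=(x_{1,M},\dots,x_{n,M})\in\mathbf R^n$, and let $P(N)=\operatorname{conv}\{v_1,\dots,v_N\}$. For a lattice polytope $P\subset\mathbf R^n$ let $L_P(t)=|tP\cap\mathbf Z^n|$ for integers $t\ge 0$, and let the coefficients $h^*_j(P)$ be defined by $$\sum_{t\ge 0}L_P(t)\,z^t=\frac{\sum_{j\ge 0}h^*_j(P)\,z^j}{(1-z)^{\dim P+1}},$$ as formal power series. Then, for every integer $N\ge 1$, the polytope $P(N)$ has dimension $n$, it contains exactly $N$ points of $\mathbf Z^n$, and $$h^*_1(P(N))=N-n-1.$$ -/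

import Mathlib

open scoped Pointwise

noncomputable section

/-- The integer lattice `ℤⁿ` inside Euclidean space `ℝⁿ`. -/
def integerLattice (n : ℕ) : Set (EuclideanSpace ℝ (Fin n)) :=
  {x | ∀ i, ∃ z : ℤ, x i = (z : ℝ)}

/-- The dimension of a subset of `ℝⁿ`: the dimension of its affine hull. -/
def polytopeDim {n : ℕ} (P : Set (EuclideanSpace ℝ (Fin n))) : ℕ :=
  Module.finrank ℝ (vectorSpan ℝ P)

/-- The Ehrhart counting function `L_P(t) = |tP ∩ ℤⁿ|`. For a nonempty `P`, `L_P(0) = 1`. -/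
def ehrhartCount {n : ℕ} (P : Set (EuclideanSpace ℝ (Fin n))) (t : ℕ) : ℕ :=
  (((t : ℝ) • P) ∩ integerLattice n).ncard

/-- The Ehrhart series `∑_{t ≥ 0} L_P(t) z ^ t`, as a formal power series. -/
def ehrhartSeries {n : ℕ} (P : Set (EuclideanSpace ℝ (Fin n))) : PowerSeries ℤ :=
  PowerSeries.mk fun t => (ehrhartCount P t : ℤ)

/-- The coefficient `h*_j` of the `h*`-polynomial of `P`, the numerator of the Ehrhart series:
`∑_{t ≥ 0} L_P(t) z ^ t = (∑_j h*_j z ^ j) / (1 - z) ^ (dim P + 1)`. -/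
def hStar {n : ℕ} (P : Set (EuclideanSpace ℝ (Fin n))) (j : ℕ) : ℤ :=
  PowerSeries.coeff j ((1 - PowerSeries.X) ^ (polytopeDim P + 1) * ehrhartSeries P)

/-- The coefficients of the expansion `L_P(t) = ∑_{j=0}^d h_j * binom(t + d - j, d)`, `d = dim P`,
are the `h*_j` (and `h*_j = 0` for `j > d`). -/
theorem hStar_eq_of_ehrhartCount_eq {n : ℕ} (P : Set (EuclideanSpace ℝ (Fin n))) (h : ℕ → ℤ)
    (hP : ∀ t : ℕ, (ehrhartCount P t : ℤ) = ∑ j ∈ Finset.range (polytopeDim P + 1),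
      h j * ((t + polytopeDim P - j).choose (polytopeDim P) : ℤ)) (j : ℕ) :
    hStar P j = if j ≤ polytopeDim P then h j else 0 := by
  unfold hStar
  set d := polytopeDim P with hd
  have key : ehrhartSeries P = (∑ j ∈ Finset.range (d + 1),
      PowerSeries.C (h j) * PowerSeries.X ^ j) * (PowerSeries.invOneSubPow ℤ (d + 1)).val := by
    ext t
    rw [Finset.sum_mul, map_sum, ehrhartSeries, PowerSeries.coeff_mk, hP]
    refine Finset.sum_congr rfl fun j hj => ?_
    rw [Finset.mem_range] at hj
    rw [mul_assoc, PowerSeries.coeff_C_mul, PowerSeries.coeff_X_pow_mul',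
      PowerSeries.invOneSubPow_val_succ_eq_mk_add_choose]
    split_ifs with hjt
    · rw [PowerSeries.coeff_mk]
      congr 3
      omega
    · rw [Nat.choose_eq_zero_of_lt (by omega)]
      simp
  have hinv : ((1 : PowerSeries ℤ) - PowerSeries.X) ^ (d + 1) *
      (PowerSeries.invOneSubPow ℤ (d + 1)).val = 1 := by
    rw [← PowerSeries.invOneSubPow_inv_eq_one_sub_pow]
    exact (PowerSeries.invOneSubPow ℤ (d + 1)).inv_val
  rw [key, mul_left_comm, hinv, mul_one, map_sum]
  simp only [PowerSeries.coeff_C_mul, PowerSeries.coeff_X_pow, mul_ite, mul_one, mul_zero,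
    Finset.sum_ite_eq, Finset.mem_range, Nat.lt_succ_iff]

/-- The point `v_M ∈ ℝⁿ`, `n = π(N)`, of exponents of `M` with respect to the first `n` primes:
the coordinate of (zero-based) index `i` is the exponent of the prime of that index. -/
def numberPoint (N M : ℕ) : EuclideanSpace ℝ (Fin N.primeCounting) :=
  WithLp.toLp 2 fun i => (M.factorization (Nat.nth Nat.Prime i) : ℝ)

/-- The lattice polytope `P(N) = conv {v_1, …, v_N}` in `ℝⁿ`, `n = π(N)`. -/
def numberPolytope (N : ℕ) : Set (EuclideanSpace ℝ (Fin N.primeCounting)) :=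
  convexHull ℝ (numberPoint N '' Set.Icc 1 N)

end

/-! Taking logarithms, M ≤ N becomes the linear inequality ∑ x_i log p_i ≤ log N on exponent
vectors. It therefore survives convex combinations, and a lattice point of P(N) has nonnegative
integer coordinates whose product ∏ p_i ^ x_i is at most N. By unique factorization these points are
exactly v_1, …, v_N, all distinct. Since v_1 = 0 and v_{p_i} = e_i, the dimension is full. Finally
h*_1 = L_P(1) - (dim P + 1) for every nonempty P. -/

theorem nth_prime_injective : Function.Injective (Nat.nth Nat.Prime) :=
  Nat.nth_injective Nat.infinite_setOfPred_prime

/-- Every prime `p ≤ N` is one of the first `π(N)` primes. -/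
theorem exists_nth_prime_eq {N p : ℕ} (hp : p.Prime) (hpN : p ≤ N) :
    ∃ i : Fin N.primeCounting, Nat.nth Nat.Prime i = p := by
  refine ⟨⟨Nat.count Nat.Prime p, ?_⟩, Nat.nth_count hp⟩
  exact Nat.count_strict_mono hp (Nat.lt_succ_of_le hpN)

theorem nth_prime_le_of_lt_primeCounting {N i : ℕ} (hi : i < N.primeCounting) :
    Nat.nth Nat.Prime i ≤ N :=
  Nat.lt_succ_iff.1 (Nat.nth_lt_of_lt_count hi)

theorem numberPoint_apply (N M : ℕ) (i : Fin N.primeCounting) :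
    numberPoint N M i = (M.factorization (Nat.nth Nat.Prime i) : ℝ) := rfl

theorem numberPoint_one (N : ℕ) : numberPoint N 1 = 0 := by
  ext i
  simp [numberPoint_apply]

theorem numberPoint_nth_prime (N : ℕ) (i : Fin N.primeCounting) :
    numberPoint N (Nat.nth Nat.Prime i) = EuclideanSpace.single i 1 := by
  ext j
  rw [numberPoint_apply, (Nat.prime_nth_prime i).factorization, PiLp.single_apply,
    Finsupp.single_apply]
  simp [nth_prime_injective.eq_iff, Fin.ext_iff, eq_comm]

theorem numberPoint_injOn (N : ℕ) : Set.InjOn (numberPoint N) (Set.Icc 1 N) := by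
  intro a ha b hb hab
  refine Nat.eq_of_factorization_eq (by have := ha.1; omega) (by have := hb.1; omega) fun p => ?_
  by_cases hp : p.Prime
  · by_cases hpN : p ≤ N
    · obtain ⟨i, rfl⟩ := exists_nth_prime_eq hp hpN
      have h := congrArg (fun v => v i) hab
      simpa [numberPoint_apply] using h
    -- A prime exceeding N divides neither number, so the first π(N) exponents suffice.
    · rw [Nat.factorization_eq_zero_of_lt (by have := ha.2; omega),
        Nat.factorization_eq_zero_of_lt (by have := hb.2; omega)]
  · simp [hp]

/-- The factors are pairwise coprime divisors of M, so their product divides M; the bound needs no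
relation between n and M. -/
theorem prod_nth_prime_pow_factorization_le (n : ℕ) {M : ℕ} (hM : M ≠ 0) :
    ∏ i : Fin n, Nat.nth Nat.Prime i ^ M.factorization (Nat.nth Nat.Prime i) ≤ M := by
  refine Nat.le_of_dvd (Nat.pos_of_ne_zero hM) (Finset.prod_dvd_of_isRelPrime ?_ ?_)
  · intro i _ j _ hij
    rw [Function.onFun, ← Nat.coprime_iff_isRelPrime]
    refine Nat.Coprime.pow _ _ ((Nat.coprime_primes (Nat.prime_nth_prime _) (Nat.prime_nth_prime _)).2 ?_)
    exact fun h => hij (Fin.ext (nth_prime_injective h))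
  · exact fun i _ => Nat.ordProj_dvd _ _

theorem factorization_prod_nth_prime_pow {n : ℕ} (k : Fin n → ℕ) (i : Fin n) :
    (∏ j : Fin n, Nat.nth Nat.Prime j ^ k j).factorization (Nat.nth Nat.Prime i) = k i := by
  rw [Nat.factorization_prod fun (j : Fin n) _ => pow_ne_zero _ (Nat.prime_nth_prime j).ne_zero,
    Finsupp.finsetSum_apply, Finset.sum_eq_single i]
  · simp
  · intro j _ hj
    have h : Nat.nth Nat.Prime j ≠ Nat.nth Nat.Prime i :=
      fun h => hj (Fin.ext (nth_prime_injective h))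
    simp [h]
  · simp

theorem log_prod_nth_prime_pow {n : ℕ} (k : Fin n → ℕ) :
    Real.log ((∏ i : Fin n, Nat.nth Nat.Prime i ^ k i : ℕ) : ℝ) =
      ∑ i, (k i : ℝ) * Real.log (Nat.nth Nat.Prime i) := by
  push_cast
  rw [Real.log_prod fun (i : Fin n) _ =>
    pow_ne_zero _ (Nat.cast_ne_zero.2 (Nat.prime_nth_prime i).ne_zero)]
  simp [Real.log_pow]

/-- `P(N)` lies in the simplex `x ≥ 0`, `∑ x_i log p_i ≤ log N`. -/
theorem numberPolytope_subset (N : ℕ) :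
    numberPolytope N ⊆ {x | (∀ i, 0 ≤ x i) ∧
      ∑ i, x i * Real.log (Nat.nth Nat.Prime i) ≤ Real.log N} := by
  refine convexHull_min ?_ ?_
  · rintro _ ⟨M, hM, rfl⟩
    have hM0 : M ≠ 0 := by have := hM.1; omega
    refine ⟨fun i => by rw [numberPoint_apply]; positivity, ?_⟩
    simp only [numberPoint_apply]
    rw [← log_prod_nth_prime_pow fun i : Fin N.primeCounting =>
      M.factorization (Nat.nth Nat.Prime i)]
    refine Real.log_le_log ?_ ?_
    · exact_mod_cast Finset.prod_pos fun (i : Fin N.primeCounting) _ =>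
        pow_pos (Nat.prime_nth_prime i).pos _
    · exact_mod_cast (prod_nth_prime_pow_factorization_le _ hM0).trans hM.2
  · rintro x ⟨hx, hx'⟩ y ⟨hy, hy'⟩ a b ha hb hab
    refine ⟨fun i => ?_, ?_⟩
    · have := hx i
      have := hy i
      simp only [PiLp.add_apply, PiLp.smul_apply, smul_eq_mul]
      positivity
    · simp only [PiLp.add_apply, PiLp.smul_apply, smul_eq_mul, add_mul, mul_assoc,
        Finset.sum_add_distrib, ← Finset.mul_sum]
      calc _ ≤ a * Real.log N + b * Real.log N := by gcongr
        _ = Real.log N := by rw [← add_mul, hab, one_mul]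

/-- The lattice points of `P(N)` are exactly `v_1, …, v_N`. -/
theorem numberPolytope_inter_integerLattice {N : ℕ} (hN : 1 ≤ N) :
    numberPolytope N ∩ integerLattice N.primeCounting = numberPoint N '' Set.Icc 1 N := by
  apply Set.Subset.antisymm
  · rintro x ⟨hxP, hxZ⟩
    obtain ⟨hx, hlog⟩ := numberPolytope_subset N hxP
    have hk : ∀ i, ∃ k : ℕ, x i = k := fun i => by
      obtain ⟨z, hz⟩ := hxZ i
      have hz0 : 0 ≤ z := Int.cast_nonneg_iff.1 (hz ▸ hx i)
      lift z to ℕ using hz0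
      exact ⟨z, by simpa using hz⟩
    choose k hk using hk
    have hpos : 0 < ∏ i : Fin N.primeCounting, Nat.nth Nat.Prime i ^ k i :=
      Finset.prod_pos fun i _ => pow_pos (Nat.prime_nth_prime i).pos _
    -- The integer with exponent vector x; the logarithmic inequality bounds it by N.
    refine ⟨∏ i : Fin N.primeCounting, Nat.nth Nat.Prime i ^ k i, ⟨hpos, ?_⟩, ?_⟩
    · simp only [hk] at hlog
      rw [← log_prod_nth_prime_pow, Real.log_le_log_iff (by exact_mod_cast hpos)
        (by exact_mod_cast hN)] at hlog
      exact_mod_cast hlog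
    · ext i
      rw [numberPoint_apply, factorization_prod_nth_prime_pow, hk]
  · rintro _ ⟨M, hM, rfl⟩
    exact ⟨subset_convexHull ℝ _ ⟨M, hM, rfl⟩, fun i => ⟨_, (Int.cast_natCast _).symm⟩⟩

theorem ncard_numberPolytope_inter_integerLattice {N : ℕ} (hN : 1 ≤ N) :
    (numberPolytope N ∩ integerLattice N.primeCounting).ncard = N := by
  rw [numberPolytope_inter_integerLattice hN, (numberPoint_injOn N).ncard_image,
    ← Finset.coe_Icc, Set.ncard_coe_finset, Nat.card_Icc, Nat.add_sub_cancel]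

theorem polytopeDim_numberPolytope {N : ℕ} (hN : 1 ≤ N) :
    polytopeDim (numberPolytope N) = N.primeCounting := by
  have htop : vectorSpan ℝ (numberPolytope N) = ⊤ := by
    rw [eq_top_iff, ← (EuclideanSpace.basisFun (Fin N.primeCounting) ℝ).toBasis.span_eq,
      Submodule.span_le]
    rintro _ ⟨i, rfl⟩
    have h1 : numberPoint N 1 ∈ numberPolytope N := subset_convexHull ℝ _ ⟨1, ⟨le_rfl, hN⟩, rfl⟩
    have hp : numberPoint N (Nat.nth Nat.Prime i) ∈ numberPolytope N :=
      subset_convexHull ℝ _ ⟨_, ⟨(Nat.prime_nth_prime i).one_le,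
        nth_prime_le_of_lt_primeCounting i.2⟩, rfl⟩
    have h := vsub_mem_vectorSpan ℝ hp h1
    rw [numberPoint_one, numberPoint_nth_prime, vsub_eq_sub, sub_zero] at h
    simpa using h
  rw [polytopeDim, htop, finrank_top, finrank_euclideanSpace_fin]

theorem ehrhartCount_zero {n : ℕ} {P : Set (EuclideanSpace ℝ (Fin n))} (hP : P.Nonempty) :
    ehrhartCount P 0 = 1 := by
  have h0 : (0 : EuclideanSpace ℝ (Fin n)) ∈ integerLattice n := fun i => ⟨0, by simp⟩
  rw [ehrhartCount, Nat.cast_zero, Set.zero_smul_set hP, ← Set.singleton_zero,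
    Set.singleton_inter_of_mem h0, Set.ncard_singleton]

theorem ehrhartCount_one {n : ℕ} (P : Set (EuclideanSpace ℝ (Fin n))) :
    ehrhartCount P 1 = (P ∩ integerLattice n).ncard := by
  rw [ehrhartCount, Nat.cast_one, one_smul]

/-- Compare coefficients of z in (1 - z)^(d+1) (1 + L_P(1) z + …); nonemptiness gives the constant
term L_P(0) = 1. -/
theorem hStar_one {n : ℕ} {P : Set (EuclideanSpace ℝ (Fin n))} (hP : P.Nonempty) :
    hStar P 1 = ((P ∩ integerLattice n).ncard : ℤ) - (polytopeDim P + 1) := by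
  have hc (m : ℕ) : PowerSeries.coeff 1 ((1 - PowerSeries.X : PowerSeries ℤ) ^ m) = -(m : ℤ) := by
    induction m with
    | zero => simp [PowerSeries.coeff_one]
    | succ m ih =>
      rw [pow_succ, mul_sub, mul_one, map_sub, ih, ← zero_add 1, PowerSeries.coeff_succ_mul_X]
      simp
      ring
  rw [hStar, PowerSeries.coeff_mul, Finset.Nat.antidiagonal_succ]
  simp [hc, ehrhartSeries, ehrhartCount_zero hP, ehrhartCount_one]
  ring

theorem mainTheorem2 (N : ℕ) (hN : 1 ≤ N) :
    polytopeDim (numberPolytope N) = N.primeCounting ∧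
    (numberPolytope N ∩ integerLattice N.primeCounting).ncard = N ∧
    hStar (numberPolytope N) 1 = (N : ℤ) - (N.primeCounting : ℤ) - 1 := by
  have hne : (numberPolytope N).Nonempty :=
    ⟨_, subset_convexHull ℝ _ ⟨1, ⟨le_rfl, hN⟩, rfl⟩⟩
  refine ⟨polytopeDim_numberPolytope hN, ncard_numberPolytope_inter_integerLattice hN, ?_⟩
  rw [hStar_one hne, ncard_numberPolytope_inter_integerLattice hN, polytopeDim_numberPolytope hN]
  ring
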